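/- Let $\mathbb F$ be a nonabelian free group of finite rank. For an integer $g\ge 0$ let $H_g=\langle a_1,b_1,\dots,a_g,b_g\rangle$ be the free group of rank $2g$ and put $\partial_g=[a_1,b_1]\cdots[a_g,b_g]\in H_g$, where $[a,b]=aba^{-1}b^{-1}$. For $x\in\mathbb F$, an admissible genus $g$ representation of $x$ is an injective homomorphism $h:H_g\to\mathbb F$ with $h(\partial_g)=x$ whose image is a primitive subgroup of $\mathbb F$, i.e. whenever $t\in\mathbb F$ and $t^k\in\operatorname{im}h$ for some integer $k\ge 1$, then $t\in\operatorname{im}h$. Define $$f'_{\mathbb F}(g)=\sup_{x\in\mathbb F}\big|\{\operatorname{im}h : h \text{ is an admissible genus } g \text{ representation of } x\}\big|\in\mathbb N\cup\{\infty\}.$$ Then for all integers $m,n\ge 0$, $$f'_{\mathbb F}(m+n)\ \ge\ f'_{\mathbb F}(m)\,f'_{\mathbb F}(n),$$ where in $\mathbb N\cup\{\infty\}$ the convention $0\cdot\infty=0$ is used. -/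

import Mathlib

/-- `H_g`, the free group on the `2 g` letters `a_1, b_1, …, a_g, b_g`: the fundamental group of
the compact orientable surface of genus `g` with one boundary component.
The letter `a_i` is `Sum.inl i`, the letter `b_i` is `Sum.inr i`. -/
abbrev SurfaceGroup (g : ℕ) : Type := FreeGroup (Fin g ⊕ Fin g)

/-- The boundary word `∂_g = [a_1, b_1] ⋯ [a_g, b_g]`, with `[a, b] = a b a⁻¹ b⁻¹`. -/
def surfaceBoundary (g : ℕ) : SurfaceGroup g :=
  (List.ofFn fun i : Fin g =>
    (FreeGroup.of (Sum.inl i) * FreeGroup.of (Sum.inr i) *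
      (FreeGroup.of (Sum.inl i))⁻¹ * (FreeGroup.of (Sum.inr i))⁻¹ : SurfaceGroup g)).prod

/-- A genus `g` representation of `x` is a homomorphism `h : H_g → F` with `h(∂_g) = x`. -/
def IsGenusRep {F : Type*} [Group F] (g : ℕ) (x : F) (h : SurfaceGroup g →* F) : Prop :=
  h (surfaceBoundary g) = x

/-- A subgroup is primitive (root-closed) if it is closed under taking roots. -/
def IsPrimitiveSubgroup {F : Type*} [Group F] (S : Subgroup F) : Prop :=
  ∀ (t : F) (n : ℕ), 0 < n → t ^ n ∈ S → t ∈ S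

/-- An admissible genus `g` representation of `x`: an injective one with primitive image. -/
def IsAdmissibleRep {F : Type*} [Group F] (g : ℕ) (x : F) (h : SurfaceGroup g →* F) : Prop :=
  IsGenusRep g x h ∧ Function.Injective h ∧ IsPrimitiveSubgroup h.range

/-- The number (possibly `⊤`) of subgroups of `F` that are images of admissible genus `g`
representations of `x`. -/
noncomputable def numAdmissibleImages {F : Type*} [Group F] (g : ℕ) (x : F) : ℕ∞ :=
  {S : Subgroup F | ∃ h : SurfaceGroup g →* F, IsAdmissibleRep g x h ∧ h.range = S}.encard

/-- `f'_F(g)`: the supremum over all `x` in `F` of the number of images of admissible genus `g`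
representations of `x`, taken in `ℕ∞`. -/
noncomputable def fPrime (F : Type*) [Group F] (g : ℕ) : ℕ∞ :=
  ⨆ x : F, numAdmissibleImages g x

/-! A nonabelian free group `F` of countable rank contains a root-closed copy of `F * F`. If `S` and
`T` are images of admissible representations of `x` and `y`, of genus `m` and `n`, then `S * T` in
`F * F` is such an image for `xy` in genus `m + n`, because the boundary word splits. The embedding
carries it into `F`, and projecting `F * F` to its factors recovers `(S, T)`, so the counts
multiply. Root-closedness is the real issue. By `IsIsolatedEmbedding.of_retraction` it suffices to
retract a root-closed overgroup onto the subgroup; the overgroups come from preimages under maps to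
semidirect products. -/

/-- An injective homomorphism whose range is closed under taking roots. -/
def IsIsolatedEmbedding {G H : Type*} [Group G] [Group H] (f : H →* G) : Prop :=
  Function.Injective f ∧ IsPrimitiveSubgroup f.range

namespace IsIsolatedEmbedding

theorem comp {G H K : Type*} [Group G] [Group H] [Group K] {g : H →* G} {f : K →* H}
    (hg : IsIsolatedEmbedding g) (hf : IsIsolatedEmbedding f) :
    IsIsolatedEmbedding (g.comp f) := by
  refine ⟨hg.1.comp hf.1, fun t k hk ⟨u, hu⟩ => ?_⟩
  obtain ⟨v, rfl⟩ := hg.2 t k hk ⟨f u, hu⟩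
  obtain ⟨w, rfl⟩ := hf.2 v k hk ⟨u, hg.1 (by simpa using hu)⟩
  exact ⟨w, rfl⟩

theorem of_mulEquiv {G H : Type*} [Group G] [Group H] (e : H ≃* G) :
    IsIsolatedEmbedding e.toMonoidHom :=
  ⟨e.injective, fun t _ _ _ => ⟨e.symm t, e.apply_symm_apply t⟩⟩

/-- In a group with unique roots, a retract of a root-closed subgroup is root-closed. -/
theorem of_retraction {G H : Type*} [Group G] [Group H] [IsMulTorsionFree G] (f : H →* G)
    (L : Subgroup G) (hL : IsPrimitiveSubgroup L) (hf : ∀ x, f x ∈ L) (r : L →* H)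
    (hr : ∀ x, r ⟨f x, hf x⟩ = x) : IsIsolatedEmbedding f := by
  refine ⟨fun x y hxy => ?_, fun t k hk ⟨x, hx⟩ => ?_⟩
  · rw [← hr x, ← hr y]
    congr 1
    exact Subtype.ext hxy
  · have ht : t ∈ L := hL t k hk (hx ▸ hf x)
    -- `f (r t)` and `t` have the same `k`-th power, and roots are unique.
    refine ⟨r ⟨t, ht⟩, ?_⟩
    have h1 : r ⟨t, ht⟩ ^ k = x := by
      rw [← map_pow]
      conv_rhs => rw [← hr x]
      congr 1
      exact Subtype.ext hx.symm
    apply IsMulTorsionFree.pow_left_injective hk.ne'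
    change f (r ⟨t, ht⟩) ^ k = t ^ k
    rw [← map_pow, h1, hx]

end IsIsolatedEmbedding

theorem IsPrimitiveSubgroup.comap {G H : Type*} [Group G] [Group H] {S : Subgroup H}
    (hS : IsPrimitiveSubgroup S) (f : G →* H) : IsPrimitiveSubgroup (S.comap f) :=
  fun t k hk ht => hS (f t) k hk (by simpa using ht)

/-! ### Root-closed subgroups of free groups -/

namespace FreeGroup

theorem isIsolatedEmbedding_map {X Y : Type*} {f : X → Y} (hf : Function.Injective f) :
    IsIsolatedEmbedding (FreeGroup.map f) := by
  classical
  let r : FreeGroup Y →* FreeGroup X :=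
    FreeGroup.lift fun y => if h : ∃ x, f x = y then FreeGroup.of h.choose else 1
  have hr : r.comp (FreeGroup.map f) = MonoidHom.id _ := by
    ext x
    have h : ∃ x', f x' = f x := ⟨x, rfl⟩
    simp only [MonoidHom.comp_apply, map.of, r, lift_apply_of, MonoidHom.id_apply, dif_pos h]
    rw [hf h.choose_spec]
  exact .of_retraction _ ⊤ (fun _ _ _ _ => trivial) (fun _ => trivial)
    (r.comp (Subgroup.subtype ⊤)) fun x => DFunLike.congr_fun hr x

/-- The action of a group `A` on the free group on `A × Y` induced by left translation. -/
def translationAut (A Y : Type*) [Group A] : A →* MulAut (FreeGroup (A × Y)) where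
  toFun a := freeGroupCongr ((Equiv.mulLeft a).prodCongr (Equiv.refl Y))
  map_one' := by
    apply MulEquiv.toMonoidHom_injective
    ext x
    simp
  map_mul' a b := by
    apply MulEquiv.toMonoidHom_injective
    ext ⟨x, y⟩
    simp [mul_assoc]

@[simp]
theorem translationAut_of {A Y : Type*} [Group A] (a : A) (p : A × Y) :
    translationAut A Y a (of p) = of (a * p.1, p.2) := by
  obtain ⟨b, y⟩ := p
  simp [translationAut]

/-- Conjugates of one basis element by powers of another span a root-closed free subgroup. -/
theorem isIsolatedEmbedding_lift_conj {X : Type*} {a b : X} (hab : a ≠ b) :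
    IsIsolatedEmbedding (FreeGroup.lift fun i : Multiplicative ℤ × Unit =>
      of a ^ i.1.toAdd * of b * (of a ^ i.1.toAdd)⁻¹) := by
  classical
  let A := Multiplicative ℤ
  -- The letter `a` becomes the shift of the basis indexed by ℤ, `b` its element at the origin;
  -- other letters die.
  let Ψ : FreeGroup X →* FreeGroup (A × Unit) ⋊[translationAut A Unit] A :=
    FreeGroup.lift fun x => if x = a then SemidirectProduct.inr (Multiplicative.ofAdd 1)
      else if x = b then SemidirectProduct.inl (of (1, ())) else 1
  have hΨa : Ψ (of a) = SemidirectProduct.inr (Multiplicative.ofAdd 1) := by simp [Ψ]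
  have hΨb : Ψ (of b) = SemidirectProduct.inl (of (1, ())) := by simp [Ψ, hab.symm]
  set ε : FreeGroup (A × Unit) →* FreeGroup X := FreeGroup.lift fun i : A × Unit =>
      of a ^ i.1.toAdd * of b * (of a ^ i.1.toAdd)⁻¹ with hε
  have hΨε : Ψ.comp ε = SemidirectProduct.inl := by
    ext1 ⟨i, u⟩
    have hi : (Multiplicative.ofAdd (1 : ℤ)) ^ i.toAdd = i := by
      rw [← ofAdd_zsmul]; simp
    rw [MonoidHom.comp_apply, hε, lift_apply_of]
    simp only [_root_.map_mul, _root_.map_inv, map_zpow, hΨa, hΨb]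
    rw [← map_zpow, hi, ← _root_.map_inv, ← SemidirectProduct.inl_aut]
    refine congrArg _ ((translationAut_of (A := Multiplicative ℤ) i (1, ())).trans ?_)
    rw [mul_one]
  -- This kernel of a map to ℤ is root-closed since ℤ is torsion-free; on it the left component of
  -- `Ψ` is multiplicative and inverts `ε`.
  let L : Subgroup (FreeGroup X) := (⊥ : Subgroup A).comap (SemidirectProduct.rightHom.comp Ψ)
  have hL : IsPrimitiveSubgroup L := by
    refine IsPrimitiveSubgroup.comap (fun t k hk ht => ?_) _
    rw [Subgroup.mem_bot] at ht ⊢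
    exact (pow_eq_one_iff_left hk.ne').1 ht
  have hmem : ∀ x, x ∈ L → (Ψ x).right = 1 := fun x hx => hx
  refine .of_retraction ε L hL (fun x => ?_)
    { toFun := fun x => (Ψ x).left
      map_one' := by simp
      map_mul' := fun x y => by
        simp [hmem x x.2] } fun x => ?_
  · change (Ψ (ε x)).right = 1
    rw [← MonoidHom.comp_apply, hΨε, SemidirectProduct.right_inl]
  · change (Ψ (ε x)).left = x
    rw [← MonoidHom.comp_apply, hΨε, SemidirectProduct.left_inl]

/-- The free product of two homomorphisms between free groups. -/
def sumMap {P Q X Y : Type*} (f : FreeGroup P →* FreeGroup X) (g : FreeGroup Q →* FreeGroup Y) :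
    FreeGroup (P ⊕ Q) →* FreeGroup (X ⊕ Y) :=
  FreeGroup.lift (Sum.elim (fun p => FreeGroup.map Sum.inl (f (of p)))
    (fun q => FreeGroup.map Sum.inr (g (of q))))

@[simp]
theorem sumMap_of_inl {P Q X Y : Type*} (f : FreeGroup P →* FreeGroup X)
    (g : FreeGroup Q →* FreeGroup Y) (p : P) :
    sumMap f g (of (Sum.inl p)) = FreeGroup.map Sum.inl (f (of p)) := by
  simp [sumMap]

@[simp]
theorem sumMap_of_inr {P Q X Y : Type*} (f : FreeGroup P →* FreeGroup X)
    (g : FreeGroup Q →* FreeGroup Y) (q : Q) :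
    sumMap f g (of (Sum.inr q)) = FreeGroup.map Sum.inr (g (of q)) := by
  simp [sumMap]

theorem sumMap_map_inl {P Q X Y : Type*} (f : FreeGroup P →* FreeGroup X)
    (g : FreeGroup Q →* FreeGroup Y) (x : FreeGroup P) :
    sumMap f g (FreeGroup.map Sum.inl x) = FreeGroup.map Sum.inl (f x) := by
  have h : (sumMap f g).comp (FreeGroup.map Sum.inl) = (FreeGroup.map Sum.inl).comp f := by
    ext p; simp
  exact DFunLike.congr_fun h x

theorem sumMap_map_inr {P Q X Y : Type*} (f : FreeGroup P →* FreeGroup X)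
    (g : FreeGroup Q →* FreeGroup Y) (x : FreeGroup Q) :
    sumMap f g (FreeGroup.map Sum.inr x) = FreeGroup.map Sum.inr (g x) := by
  have h : (sumMap f g).comp (FreeGroup.map Sum.inr) = (FreeGroup.map Sum.inr).comp g := by
    ext p; simp
  exact DFunLike.congr_fun h x

theorem range_sumMap {P Q X Y : Type*} (f : FreeGroup P →* FreeGroup X)
    (g : FreeGroup Q →* FreeGroup Y) :
    (sumMap f g).range =
      f.range.map (FreeGroup.map Sum.inl) ⊔ g.range.map (FreeGroup.map Sum.inr) := by
  apply le_antisymm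
  · refine range_lift_le ?_
    rintro _ ⟨p | q, rfl⟩
    · exact Subgroup.mem_sup_left ⟨f (of p), ⟨_, rfl⟩, rfl⟩
    · exact Subgroup.mem_sup_right ⟨g (of q), ⟨_, rfl⟩, rfl⟩
  · refine sup_le ?_ ?_
    · rintro _ ⟨_, ⟨x, rfl⟩, rfl⟩
      exact ⟨_, sumMap_map_inl f g x⟩
    · rintro _ ⟨_, ⟨x, rfl⟩, rfl⟩
      exact ⟨_, sumMap_map_inr f g x⟩

/-- `F(X) * F(Y)` is `N ⋊ F(X)`, with `N` free on the conjugates of `Y` by `F(X)`. The preimage `N ⋊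
f.range` of `f.range` is root-closed and retracts onto the free product of `f.range` and `F(Y)`. -/
theorem isIsolatedEmbedding_sumMap_id {P X : Type*} (Y : Type*) {f : FreeGroup P →* FreeGroup X}
    (hf : IsIsolatedEmbedding f) :
    IsIsolatedEmbedding (sumMap f (MonoidHom.id (FreeGroup Y))) := by
  classical
  let A := FreeGroup X
  let Ψ : FreeGroup (X ⊕ Y) →* FreeGroup (A × Y) ⋊[translationAut A Y] A :=
    FreeGroup.lift (Sum.elim (fun x => SemidirectProduct.inr (of x))
      (fun y => SemidirectProduct.inl (of (1, y))))
  have hΨl : ∀ a, Ψ (FreeGroup.map Sum.inl a) = SemidirectProduct.inr a := by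
    have h : Ψ.comp (FreeGroup.map Sum.inl) = SemidirectProduct.inr := by
      ext1 x; simp [Ψ]
    exact fun a => DFunLike.congr_fun h a
  have hΨr : ∀ y, Ψ (of (Sum.inr y)) = SemidirectProduct.inl (of (1, y)) := by
    intro y; simp [Ψ]
  let e : FreeGroup P ≃* f.range := MonoidHom.ofInjective hf.1
  have he : ∀ p h, e.symm ⟨f p, h⟩ = p := fun p h => by
    rw [MulEquiv.symm_apply_eq]; rfl
  let j : f.range →* FreeGroup (P ⊕ Y) := (FreeGroup.map Sum.inl).comp e.symm.toMonoidHom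
  -- Conjugates by elements outside `f.range` are killed. Left translation by `f.range` preserves
  -- its complement, so `θ` is equivariant.
  let θ : FreeGroup (A × Y) →* FreeGroup (P ⊕ Y) :=
    FreeGroup.lift fun p => if h : p.1 ∈ f.range then j ⟨p.1, h⟩ * of (Sum.inr p.2) * (j ⟨p.1, h⟩)⁻¹
      else 1
  have hθ : ∀ (s : f.range) (n : FreeGroup (A × Y)),
      θ (translationAut A Y s n) = j s * θ n * (j s)⁻¹ := by
    intro s n
    have h : θ.comp (translationAut A Y s).toMonoidHom =
        (MulAut.conj (j s)).toMonoidHom.comp θ := by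
      ext1 ⟨a, y⟩
      simp only [MonoidHom.comp_apply, MulEquiv.coe_toMonoidHom, translationAut_of, θ,
        lift_apply_of, MulAut.conj_apply]
      by_cases ha : a ∈ f.range
      · have hsa : (s : A) * a ∈ f.range := mul_mem s.2 ha
        have : (⟨s * a, hsa⟩ : f.range) = s * ⟨a, ha⟩ := rfl
        rw [dif_pos ha, dif_pos hsa, this, _root_.map_mul]
        group
      · have hsa : (s : A) * a ∉ f.range := fun h => ha ((Subgroup.mul_mem_cancel_left _ s.2).1 h)
        rw [dif_neg ha, dif_neg hsa]
        group
    exact DFunLike.congr_fun h n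
  let L : Subgroup (FreeGroup (X ⊕ Y)) := f.range.comap (SemidirectProduct.rightHom.comp Ψ)
  have hL : IsPrimitiveSubgroup L := hf.2.comap _
  have hmem : ∀ x, x ∈ L → (Ψ x).right ∈ f.range := fun x hx => hx
  have hFL : ∀ x, sumMap f (MonoidHom.id (FreeGroup Y)) x ∈ L := by
    have : (sumMap f (MonoidHom.id (FreeGroup Y))).range ≤ L := by
      refine range_lift_le ?_
      rintro _ ⟨p | q, rfl⟩
      · change (Ψ (FreeGroup.map Sum.inl (f (of p)))).right ∈ f.range
        rw [hΨl]
        exact ⟨_, rfl⟩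
      · change (Ψ (of (Sum.inr q))).right ∈ f.range
        rw [hΨr]
        exact one_mem _
    exact fun x => this ⟨x, rfl⟩
  let r : L →* FreeGroup (P ⊕ Y) :=
    { toFun := fun x => θ (Ψ x).left * j ⟨(Ψ x).right, hmem x x.2⟩
      map_one' := by
        have : (⟨(Ψ (1 : L)).right, hmem _ (1 : L).2⟩ : f.range) = 1 := by
          ext1; simp
        rw [this]; simp
      map_mul' := fun x y => by
        have h1 : (⟨(Ψ (x * y : L)).right, hmem _ (x * y : L).2⟩ : f.range) =
            ⟨(Ψ x).right, hmem x x.2⟩ * ⟨(Ψ y).right, hmem y y.2⟩ := by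
          ext1; simp
        have h2 := hθ ⟨(Ψ x).right, hmem x x.2⟩ (Ψ y).left
        rw [h1, _root_.map_mul, Subgroup.coe_mul, _root_.map_mul, SemidirectProduct.mul_left, _root_.map_mul, h2]
        group }
  have hr : r.comp ((sumMap f (MonoidHom.id (FreeGroup Y))).codRestrict L hFL) =
      MonoidHom.id _ := by
    ext1 (p | q)
    · have h1 : (⟨sumMap f (MonoidHom.id _) (of (Sum.inl p)), hFL _⟩ : L) =
          ⟨FreeGroup.map Sum.inl (f (of p)), sumMap_of_inl f (.id _) p ▸ hFL _⟩ :=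
        Subtype.ext (sumMap_of_inl _ _ _)
      change r ⟨sumMap f (MonoidHom.id _) (of (Sum.inl p)), hFL _⟩ = of (Sum.inl p)
      rw [h1]
      simp only [r, MonoidHom.coe_mk, OneHom.coe_mk, hΨl, SemidirectProduct.left_inr,
        SemidirectProduct.right_inr, _root_.map_one, one_mul]
      change FreeGroup.map Sum.inl (e.symm _) = _
      rw [he, map.of]
    · have h1 : (⟨sumMap f (MonoidHom.id _) (of (Sum.inr q)), hFL _⟩ : L) =
          ⟨of (Sum.inr q), by simpa using hFL (of (Sum.inr q))⟩ :=
        Subtype.ext (by simp)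
      have h2 : (⟨1, one_mem _⟩ : f.range) = 1 := rfl
      change r ⟨sumMap f (MonoidHom.id _) (of (Sum.inr q)), hFL _⟩ = of (Sum.inr q)
      rw [h1]
      simp only [r, MonoidHom.coe_mk, OneHom.coe_mk, hΨr, SemidirectProduct.left_inl,
        SemidirectProduct.right_inl, h2, _root_.map_one, mul_one, θ, lift_apply_of,
        dif_pos (one_mem f.range), one_mul, inv_one]
  exact .of_retraction _ L hL hFL r fun x => DFunLike.congr_fun hr x

theorem isIsolatedEmbedding_id_sumMap {Q Y : Type*} (P : Type*) {g : FreeGroup Q →* FreeGroup Y}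
    (hg : IsIsolatedEmbedding g) :
    IsIsolatedEmbedding (sumMap (MonoidHom.id (FreeGroup P)) g) := by
  have h := ((IsIsolatedEmbedding.of_mulEquiv (freeGroupCongr (Equiv.sumComm Y P))).comp
    (isIsolatedEmbedding_sumMap_id P hg)).comp
      (.of_mulEquiv (freeGroupCongr (Equiv.sumComm P Q)))
  convert h using 1
  ext1 (p | q)
  · simp [sumMap]
  · simp only [sumMap, lift_apply_of, Sum.elim_inr, MonoidHom.comp_apply,
      MulEquiv.coe_toMonoidHom, freeGroupCongr_apply, map.of, Equiv.sumComm_apply, Sum.swap_inr,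
      Sum.elim_inl, map.comp]
    rfl

theorem isIsolatedEmbedding_sumMap {P Q X Y : Type*} {f : FreeGroup P →* FreeGroup X}
    {g : FreeGroup Q →* FreeGroup Y} (hf : IsIsolatedEmbedding f) (hg : IsIsolatedEmbedding g) :
    IsIsolatedEmbedding (sumMap f g) := by
  have h := (isIsolatedEmbedding_sumMap_id Y hf).comp (isIsolatedEmbedding_id_sumMap P hg)
  convert h using 1
  ext1 (p | q)
  · simp
  · simp [sumMap_map_inr]

/-- A subgroup is determined by its free product with another subgroup. -/
theorem sup_map_inl_map_inr_injective {X Y : Type*} {S S' : Subgroup (FreeGroup X)}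
    {T T' : Subgroup (FreeGroup Y)}
    (h : S.map (FreeGroup.map Sum.inl) ⊔ T.map (FreeGroup.map Sum.inr) =
      (S'.map (FreeGroup.map Sum.inl) ⊔ T'.map (FreeGroup.map Sum.inr) :
        Subgroup (FreeGroup (X ⊕ Y)))) : S = S' ∧ T = T' := by
  let p : FreeGroup (X ⊕ Y) →* FreeGroup X := FreeGroup.lift (Sum.elim of 1)
  let q : FreeGroup (X ⊕ Y) →* FreeGroup Y := FreeGroup.lift (Sum.elim 1 of)
  have hpl : p.comp (FreeGroup.map Sum.inl) = MonoidHom.id _ := by ext1; simp [p]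
  have hpr : p.comp (FreeGroup.map Sum.inr) = 1 := by ext1; simp [p]
  have hql : q.comp (FreeGroup.map Sum.inl) = 1 := by ext1; simp [q]
  have hqr : q.comp (FreeGroup.map Sum.inr) = MonoidHom.id _ := by ext1; simp [q]
  constructor
  · simpa [Subgroup.map_sup, Subgroup.map_map, hpl, hpr, Subgroup.map_one_eq_bot] using
      congrArg (Subgroup.map p) h
  · simpa [Subgroup.map_sup, Subgroup.map_map, hql, hqr, Subgroup.map_one_eq_bot] using
      congrArg (Subgroup.map q) h

/-- A countably generated nonabelian free group contains its free square as a root-closed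
subgroup. -/
theorem exists_isIsolatedEmbedding_sum (X : Type*) [Countable X] [Nontrivial X] :
    ∃ Φ : FreeGroup (X ⊕ X) →* FreeGroup X, IsIsolatedEmbedding Φ := by
  obtain ⟨a, b, hab⟩ := exists_pair_ne X
  obtain ⟨c, hc⟩ := exists_injective_nat (X ⊕ X)
  -- Countability lets distinct letters go to distinct conjugates of `b` by powers of `a`.
  refine ⟨_, (isIsolatedEmbedding_lift_conj hab).comp (isIsolatedEmbedding_map
    (f := fun x => (Multiplicative.ofAdd (c x : ℤ), ())) fun x y hxy => hc ?_)⟩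
  simpa using hxy

end FreeGroup

/-! ### Boundary connected sums and counting -/

/-- The free splitting of the surface group of genus `m + n` as a boundary connected sum. -/
def surfaceGroupAddEquiv (m n : ℕ) :
    SurfaceGroup (m + n) ≃* FreeGroup ((Fin m ⊕ Fin m) ⊕ (Fin n ⊕ Fin n)) :=
  FreeGroup.freeGroupCongr
    ((Equiv.sumCongr finSumFinEquiv.symm finSumFinEquiv.symm).trans
      (Equiv.sumSumSumComm (Fin m) (Fin n) (Fin m) (Fin n)))

theorem surfaceGroupAddEquiv_surfaceBoundary (m n : ℕ) :
    surfaceGroupAddEquiv m n (surfaceBoundary (m + n)) =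
      FreeGroup.map Sum.inl (surfaceBoundary m) * FreeGroup.map Sum.inr (surfaceBoundary n) := by
  simp only [surfaceBoundary, List.ofFn_add, List.prod_append, map_mul, map_list_prod,
    List.map_ofFn]
  congr 3
  · funext i
    have hi (h : m ≤ m + n) : finSumFinEquiv.symm (Fin.castLE h i) = Sum.inl i :=
      finSumFinEquiv_symm_apply_castAdd i
    simp [surfaceGroupAddEquiv, hi]
  · funext i
    simp [surfaceGroupAddEquiv]

theorem fPrime_freeGroup_mul_le {X : Type*} [Countable X] [Nontrivial X] (m n : ℕ) :
    fPrime (FreeGroup X) m * fPrime (FreeGroup X) n ≤ fPrime (FreeGroup X) (m + n) := by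
  obtain ⟨Φ, hΦ⟩ := FreeGroup.exists_isIsolatedEmbedding_sum X
  simp only [fPrime, ENat.iSup_mul, ENat.mul_iSup]
  refine iSup_le fun y => iSup_le fun x => ?_
  refine le_trans ?_ (le_iSup _ (Φ (FreeGroup.map Sum.inl x * FreeGroup.map Sum.inr y)))
  rw [numAdmissibleImages, numAdmissibleImages, ← Set.encard_prod]
  refine Set.encard_le_encard_of_injOn (f := fun p : Subgroup (FreeGroup X) × Subgroup (FreeGroup X)
    => (p.1.map (FreeGroup.map Sum.inl) ⊔ p.2.map (FreeGroup.map Sum.inr) :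
      Subgroup (FreeGroup (X ⊕ X))).map Φ) ?_ ?_
  · rintro ⟨_, _⟩ ⟨⟨h, ⟨hx, hh⟩, rfl⟩, ⟨k, ⟨hy, hk⟩, rfl⟩⟩
    have hx : h (surfaceBoundary m) = x := hx
    have hy : k (surfaceBoundary n) = y := hy
    refine ⟨(Φ.comp (FreeGroup.sumMap h k)).comp (surfaceGroupAddEquiv m n).toMonoidHom,
      ⟨?_, (hΦ.comp (FreeGroup.isIsolatedEmbedding_sumMap hh hk)).comp
        (.of_mulEquiv (surfaceGroupAddEquiv m n))⟩, ?_⟩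
    · change Φ (FreeGroup.sumMap h k (surfaceGroupAddEquiv m n (surfaceBoundary (m + n)))) = _
      rw [surfaceGroupAddEquiv_surfaceBoundary, map_mul, FreeGroup.sumMap_map_inl,
        FreeGroup.sumMap_map_inr, hx, hy]
    · have h1 : (surfaceGroupAddEquiv m n).toMonoidHom.range = ⊤ :=
        MonoidHom.range_eq_top.2 (surfaceGroupAddEquiv m n).surjective
      rw [MonoidHom.range_comp, h1, ← MonoidHom.range_eq_map, MonoidHom.range_comp, FreeGroup.range_sumMap]
  · rintro ⟨S, T⟩ _ ⟨S', T'⟩ _ h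
    obtain ⟨rfl, rfl⟩ := FreeGroup.sup_map_inl_map_inr_injective (Subgroup.map_injective hΦ.1 h)
    rfl

theorem fPrime_le_of_mulEquiv {F G : Type*} [Group F] [Group G] (e : F ≃* G) (g : ℕ) :
    fPrime F g ≤ fPrime G g := by
  refine iSup_le fun x => le_trans ?_ (le_iSup _ (e x))
  refine Set.encard_le_encard_of_injOn (f := Subgroup.map e.toMonoidHom) ?_
    (Subgroup.map_injective e.injective).injOn
  rintro _ ⟨h, ⟨hx, hh⟩, rfl⟩
  have hx : h (surfaceBoundary g) = x := hx
  exact ⟨e.toMonoidHom.comp h, ⟨congrArg e hx, (IsIsolatedEmbedding.of_mulEquiv e).comp hh⟩,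
    MonoidHom.range_comp _ _⟩

theorem fPrime_congr {F G : Type*} [Group F] [Group G] (e : F ≃* G) (g : ℕ) :
    fPrime F g = fPrime G g :=
  le_antisymm (fPrime_le_of_mulEquiv e g) (fPrime_le_of_mulEquiv e.symm g)

theorem Group.FG.countable {G : Type*} [Group G] [Group.FG G] : Countable G := by
  obtain ⟨α, _, φ, hφ⟩ := Group.fg_iff_exists_freeGroup_hom_surjective_finite.1 ‹Group.FG G›
  exact hφ.countable

theorem mainTheorem6 {F : Type*} [Group F] [IsFreeGroup F] [Group.FG F]
    (hF : ∃ a b : F, a * b ≠ b * a) (m n : ℕ) :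
    fPrime F m * fPrime F n ≤ fPrime F (m + n) := by
  let X := IsFreeGroup.Generators F
  let e : F ≃* FreeGroup X := IsFreeGroup.toFreeGroup F
  have : Countable F := Group.FG.countable
  have : Countable X :=
    (e.symm.injective.comp FreeGroup.of_injective).countable
  -- Rank at most one would make `F` trivial or cyclic, hence abelian.
  have : Nontrivial X := by
    by_contra hX
    rw [not_nontrivial_iff_subsingleton] at hX
    obtain ⟨a, b, hab⟩ := hF
    refine hab (e.injective ?_)
    rw [map_mul, map_mul]
    rcases isEmpty_or_nonempty X with _ | ⟨⟨x⟩⟩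
    · exact Subsingleton.elim _ _
    · have hz : ∀ w : FreeGroup X, w ∈ Subgroup.zpowers (FreeGroup.of x) := by
        intro w
        have : (⊤ : Subgroup (FreeGroup X)) ≤ Subgroup.zpowers (FreeGroup.of x) := by
          rw [← FreeGroup.closure_range_of, Subgroup.closure_le]
          rintro _ ⟨y, rfl⟩
          rw [Subsingleton.elim y x]
          exact Subgroup.mem_zpowers _
        exact this trivial
      obtain ⟨i, hi⟩ := hz (e a)
      obtain ⟨k, hk⟩ := hz (e b)
      rw [← hi, ← hk]
      exact zpow_mul_comm _ i k
  rw [fPrime_congr e, fPrime_congr e, fPrime_congr e]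
  exact fPrime_freeGroup_mul_le m n
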